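/- Let $d\ge 1$, let $\Omega\subset\mathbb{R}^d$ be a bounded domain with $C^\infty$ boundary, with outer unit normal $\nu$ and surface measure $\sigma$ on $\partial\Omega$, and let $T>0$, $\varepsilon>0$ and $N\in\mathbb{N}$. Let ${\bf a}\in C^1(\Omega)$ with ${\bf a}\ge 1$, let $a,{\bf c}\in L^\infty(\Omega)$ and ${\bf b}\in L^\infty(\Omega;\mathbb{R}^d)$ (all real valued), and put $$L\phi=\Delta\phi+{\bf b}\cdot\nabla\phi+{\bf c}\,\phi .$$ Let $\{\Psi_n\}_{n\ge1}$ be an orthonormal basis of $L^2(0,T)$ consisting of functions in $C^2([0,T])$, and for $1\le m,n\le N$ let $$s_{mn}(x)=\int_0^T\big[{\bf a}(x)\Psi_n''(t)+a(x)\Psi_n'(t)\big]\Psi_m(t)\,dt,\qquad x\in\Omega .$$ Let $f_1\in L^2(\partial\Omega\times(0,T))$. For ${\bf u}=(u_1,\dots,u_N)\in H^2(\Omega)^N$ define $$J({\bf u})=\sum_{m=1}^N\int_\Omega\Big|Lu_m-\sum_{n=1}^N s_{mn}u_n\Big|^2dx+\sum_{m=1}^N\int_{\partial\Omega}\Big|\partial_\nu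 u_m-\int_0^T f_1(x,t)\Psi_m(t)\,dt\Big|^2d\sigma+\varepsilon\sum_{m=1}^N\|u_m\|_{H^2(\Omega)}^2\ \in[0,\infty],$$ where $\|u\|_{H^2(\Omega)}^2=\|u\|_{L^2(\Omega)}^2+\sum_i\|\partial_iu\|_{L^2(\Omega)}^2+\sum_{i,j}\|\partial_i\partial_ju\|_{L^2(\Omega)}^2$ and boundary values are taken in the sense of traces. Then $$H=\{{\bf u}\in H^2(\Omega)^N:\ {\bf u}|_{\partial\Omega}=0\}$$ is a closed subspace of $H^2(\Omega)^N$, and $J$ has a unique minimizer in $H$: there is exactly one ${\bf u}\in H$ with $J({\bf u})\le J({\bf v})$ for all ${\bf v}\in H$. -/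

import Mathlib

open MeasureTheory Set Filter Topology
open scoped ENNReal ContDiff Gradient

noncomputable section

/-- The Euclidean space `ℝ^d`. -/
abbrev Euc (d : ℕ) : Type := EuclideanSpace ℝ (Fin d)

/-- The classical partial derivative `∂_i φ`. -/
def pderiv {d : ℕ} (i : Fin d) (φ : Euc d → ℝ) (x : Euc d) : ℝ :=
  fderiv ℝ φ x (EuclideanSpace.single i 1)

/-! ### Smooth bounded domains, surface measure and outer normal -/

/-- `ρ` is a smooth defining function of `Ω` near the boundary point `x`: it is `C^∞`, has
non-vanishing gradient at `x`, and `Ω = {ρ < 0}` in a neighbourhood of `x`. -/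
structure IsLocalDefiningFunction {d : ℕ} (Ω : Set (Euc d)) (x : Euc d) (ρ : Euc d → ℝ) :
    Prop where
  contDiff : ContDiff ℝ ∞ ρ
  gradient_ne_zero : ∇ ρ x ≠ 0
  eventually_mem_iff : ∀ᶠ y in 𝓝 x, (y ∈ Ω ↔ ρ y < 0)

/-- A bounded domain (non-empty, open, connected) of `ℝ^d` with `C^∞` boundary. -/
structure IsSmoothBoundedDomain {d : ℕ} (Ω : Set (Euc d)) : Prop where
  isOpen : IsOpen Ω
  isConnected : IsConnected Ω
  isBounded : Bornology.IsBounded Ω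
  smooth_boundary : ∀ x ∈ frontier Ω, ∃ ρ, IsLocalDefiningFunction Ω x ρ

/-- The surface measure `σ` on `∂Ω`: the `(d-1)`-dimensional Hausdorff measure, normalized so as to
agree with Lebesgue measure on `ℝ^(d-1)` (counting measure if `d = 1`), restricted to `∂Ω`. -/
def surfaceMeasure {d : ℕ} (Ω : Set (Euc d)) : Measure (Euc d) :=
  (Measure.euclideanHausdorffMeasure (d - 1) : Measure (Euc d)).restrict (frontier Ω)

open Classical in
/-- The outer unit normal `ν = ∇ρ / |∇ρ|` at a boundary point, where `ρ` is a local defining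
function (the quotient does not depend on the choice of `ρ`). -/
def outerNormal {d : ℕ} (Ω : Set (Euc d)) (x : Euc d) : Euc d :=
  if h : ∃ ρ, IsLocalDefiningFunction Ω x ρ then
    ‖∇ h.choose x‖⁻¹ • ∇ h.choose x
  else 0

/-! ### The Sobolev space `H²(Ω)` -/

/-- The real Hilbert space `L²(Ω)`. -/
abbrev L2 {d : ℕ} (Ω : Set (Euc d)) : Type := Lp ℝ 2 (volume.restrict Ω)

/-- `w ∈ L²(Ω)` is the weak partial derivative `∂_i v` of `v ∈ L²(Ω)` in `Ω`. -/
def IsWeakPartial {d : ℕ} (Ω : Set (Euc d)) (i : Fin d) (v w : L2 Ω) : Prop :=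
  ∀ φ : Euc d → ℝ, ContDiff ℝ ∞ φ → HasCompactSupport φ → tsupport φ ⊆ Ω →
    ∫ x in Ω, v x * pderiv i φ x = - ∫ x in Ω, w x * φ x

/-- Labels for a function, its first partial derivatives and its second partial derivatives. -/
abbrev DerivIdx (d : ℕ) : Type := Unit ⊕ (Fin d ⊕ Fin d × Fin d)

/-- Families `(v, (v_i)_i, (v_ij)_ij)` of elements of `L²(Ω)`, with the Hilbert norm
`(‖v‖² + ∑_i ‖v_i‖² + ∑_ij ‖v_ij‖²)^(1/2)`. -/
abbrev Jets {d : ℕ} (Ω : Set (Euc d)) : Type := PiLp 2 (fun _ : DerivIdx d => L2 Ω)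

lemma memLp_of_smooth {d : ℕ} (Ω : Set (Euc d)) {φ : Euc d → ℝ} (hφ : Continuous φ)
    (hc : HasCompactSupport φ) : MemLp φ 2 (volume.restrict Ω) :=
  (hφ.memLp_of_hasCompactSupport hc).restrict Ω

lemma continuous_pderiv {d : ℕ} (i : Fin d) {φ : Euc d → ℝ} (hφ : ContDiff ℝ ∞ φ) :
    Continuous (pderiv i φ) :=
  (hφ.continuous_fderiv (by simp)).clm_apply continuous_const

lemma hasCompactSupport_pderiv {d : ℕ} (i : Fin d) {φ : Euc d → ℝ} (hc : HasCompactSupport φ) :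
    HasCompactSupport (pderiv i φ) :=
  hc.fderiv_apply (𝕜 := ℝ) _

lemma integral_add_mul {d : ℕ} {Ω : Set (Euc d)} (v w : L2 Ω) {φ : Euc d → ℝ}
    (hφ : MemLp φ 2 (volume.restrict Ω)) :
    ∫ x in Ω, (v + w : L2 Ω) x * φ x = (∫ x in Ω, v x * φ x) + ∫ x in Ω, w x * φ x := by
  have hv : Integrable (fun x => v x * φ x) (volume.restrict Ω) :=
    (Lp.memLp v).integrable_mul hφ
  have hw : Integrable (fun x => w x * φ x) (volume.restrict Ω) :=
    (Lp.memLp w).integrable_mul hφ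
  rw [← integral_add hv hw]
  refine integral_congr_ae ?_
  filter_upwards [Lp.coeFn_add v w] with x hx
  rw [hx, Pi.add_apply, add_mul]

lemma integral_smul_mul {d : ℕ} {Ω : Set (Euc d)} (r : ℝ) (v : L2 Ω) (φ : Euc d → ℝ) :
    ∫ x in Ω, (r • v : L2 Ω) x * φ x = r * ∫ x in Ω, v x * φ x := by
  rw [← integral_const_mul]
  refine integral_congr_ae ?_
  filter_upwards [Lp.coeFn_smul r v] with x hx
  simp [hx, mul_assoc]

lemma integral_zero_mul {d : ℕ} {Ω : Set (Euc d)} (φ : Euc d → ℝ) :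
    ∫ x in Ω, (0 : L2 Ω) x * φ x = 0 := by
  have := integral_smul_mul (Ω := Ω) 0 0 φ
  simpa using this

lemma IsWeakPartial.zero {d : ℕ} {Ω : Set (Euc d)} {i : Fin d} :
    IsWeakPartial Ω i 0 0 := by
  intro φ _ _ _
  rw [integral_zero_mul, integral_zero_mul, neg_zero]

lemma IsWeakPartial.add {d : ℕ} {Ω : Set (Euc d)} {i : Fin d} {v w v' w' : L2 Ω}
    (h : IsWeakPartial Ω i v w) (h' : IsWeakPartial Ω i v' w') :
    IsWeakPartial Ω i (v + v') (w + w') := by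
  intro φ hφ hc hs
  rw [integral_add_mul _ _ (memLp_of_smooth Ω (continuous_pderiv i hφ)
    (hasCompactSupport_pderiv i hc)), integral_add_mul _ _ (memLp_of_smooth Ω hφ.continuous hc),
    h φ hφ hc hs, h' φ hφ hc hs]
  ring

lemma IsWeakPartial.smul {d : ℕ} {Ω : Set (Euc d)} {i : Fin d} {v w : L2 Ω}
    (r : ℝ) (h : IsWeakPartial Ω i v w) : IsWeakPartial Ω i (r • v) (r • w) := by
  intro φ hφ hc hs
  rw [integral_smul_mul, integral_smul_mul, h φ hφ hc hs]
  ring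

/-- The Sobolev space `H²(Ω)`. A function of `H²(Ω)` is stored together with its weak derivatives of
order one and two, which it determines uniquely; this realizes `H²(Ω)` as a subspace of a finite
power of `L²(Ω)` and gives it the norm
`‖u‖² = ‖u‖²_{L²} + ∑_i ‖∂_i u‖²_{L²} + ∑_ij ‖∂_j ∂_i u‖²_{L²}`. -/
def H2 {d : ℕ} (Ω : Set (Euc d)) : Submodule ℝ (Jets Ω) where
  carrier := {U | (∀ i, IsWeakPartial Ω i (U (.inl ())) (U (.inr (.inl i)))) ∧
    ∀ i j, IsWeakPartial Ω j (U (.inr (.inl i))) (U (.inr (.inr (i, j))))}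
  zero_mem' := ⟨fun _ => IsWeakPartial.zero, fun _ _ => IsWeakPartial.zero⟩
  add_mem' := fun hU hV =>
    ⟨fun i => (hU.1 i).add (hV.1 i), fun i j => (hU.2 i j).add (hV.2 i j)⟩
  smul_mem' := fun r _ hU => ⟨fun i => (hU.1 i).smul r, fun i j => (hU.2 i j).smul r⟩

/-- The underlying function of an element of `H²(Ω)`. -/
def sobFn {d : ℕ} {Ω : Set (Euc d)} (u : H2 Ω) : L2 Ω := u.1 (.inl ())

/-- The weak derivative `∂_i u`. -/
def sobGrad {d : ℕ} {Ω : Set (Euc d)} (u : H2 Ω) (i : Fin d) : L2 Ω := u.1 (.inr (.inl i))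

/-- The weak derivative `∂_j ∂_i u`. -/
def sobHess {d : ℕ} {Ω : Set (Euc d)} (u : H2 Ω) (i j : Fin d) : L2 Ω := u.1 (.inr (.inr (i, j)))

/-! ### Traces on the boundary -/

/-- `g` is the trace `u|_∂Ω ∈ L²(∂Ω)`: the restriction to `∂Ω`, extended by continuity from functions
smooth up to the boundary, with respect to convergence in `H¹(Ω)`. -/
def IsTrace {d : ℕ} (Ω : Set (Euc d)) (u : H2 Ω) (g : Lp ℝ 2 (surfaceMeasure Ω)) : Prop :=
  ∃ φ : ℕ → Euc d → ℝ, (∀ k, ContDiff ℝ ∞ (φ k)) ∧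
    Tendsto (fun k => eLpNorm (fun x => φ k x - sobFn u x) 2 (volume.restrict Ω)) atTop (𝓝 0) ∧
    (∀ i, Tendsto (fun k => eLpNorm (fun x => pderiv i (φ k) x - sobGrad u i x) 2
      (volume.restrict Ω)) atTop (𝓝 0)) ∧
    Tendsto (fun k => eLpNorm (fun x => φ k x - g x) 2 (surfaceMeasure Ω)) atTop (𝓝 0)

/-- `g` is the normal derivative `∂_ν u ∈ L²(∂Ω)`: the classical normal derivative `∇φ · ν`, extended
by continuity from functions smooth up to the boundary, with respect to convergence in `H²(Ω)`. -/
def IsNormalDeriv {d : ℕ} (Ω : Set (Euc d)) (u : H2 Ω) (g : Lp ℝ 2 (surfaceMeasure Ω)) : Prop :=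
  ∃ φ : ℕ → Euc d → ℝ, (∀ k, ContDiff ℝ ∞ (φ k)) ∧
    Tendsto (fun k => eLpNorm (fun x => φ k x - sobFn u x) 2 (volume.restrict Ω)) atTop (𝓝 0) ∧
    (∀ i, Tendsto (fun k => eLpNorm (fun x => pderiv i (φ k) x - sobGrad u i x) 2
      (volume.restrict Ω)) atTop (𝓝 0)) ∧
    (∀ i j, Tendsto (fun k => eLpNorm (fun x => pderiv j (pderiv i (φ k)) x - sobHess u i j x) 2
      (volume.restrict Ω)) atTop (𝓝 0)) ∧
    Tendsto (fun k => eLpNorm (fun x => fderiv ℝ (φ k) x (outerNormal Ω x) - g x) 2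
      (surfaceMeasure Ω)) atTop (𝓝 0)

lemma tendsto_eLpNorm_add {d : ℕ} {μ : Measure (Euc d)} {f g : ℕ → Euc d → ℝ}
    {a b c : Lp ℝ 2 μ}
    (hf : ∀ k, Continuous (f k)) (hg : ∀ k, Continuous (g k))
    (h₁ : Tendsto (fun k => eLpNorm (fun x => f k x - a x) 2 μ) atTop (𝓝 0))
    (h₂ : Tendsto (fun k => eLpNorm (fun x => g k x - b x) 2 μ) atTop (𝓝 0))
    (hc : c = a + b) :
    Tendsto (fun k => eLpNorm (fun x => f k x + g k x - c x) 2 μ) atTop (𝓝 0) := by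
  refine tendsto_of_tendsto_of_tendsto_of_le_of_le tendsto_const_nhds
    (by simpa using h₁.add h₂) (fun k => zero_le) (fun k => ?_)
  refine le_trans (le_of_eq (eLpNorm_congr_ae ?_)) (eLpNorm_add_le
    ((hf k).aestronglyMeasurable.sub (Lp.aestronglyMeasurable a))
    ((hg k).aestronglyMeasurable.sub (Lp.aestronglyMeasurable b)) (by norm_num))
  subst hc
  filter_upwards [Lp.coeFn_add a b] with x hx
  simp only [hx, Pi.add_apply]
  ring

lemma tendsto_eLpNorm_smul {d : ℕ} {μ : Measure (Euc d)} {f : ℕ → Euc d → ℝ}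
    {a c : Lp ℝ 2 μ} (r : ℝ)
    (h₁ : Tendsto (fun k => eLpNorm (fun x => f k x - a x) 2 μ) atTop (𝓝 0))
    (hc : c = r • a) :
    Tendsto (fun k => eLpNorm (fun x => r * f k x - c x) 2 μ) atTop (𝓝 0) := by
  have h₂ : Tendsto (fun k => ‖r‖ₑ * eLpNorm (fun x => f k x - a x) 2 μ) atTop (𝓝 0) := by
    simpa using ENNReal.Tendsto.const_mul h₁ (Or.inr (enorm_ne_top (x := r)))
  refine h₂.congr (fun k => ?_)
  rw [← eLpNorm_const_smul]
  refine eLpNorm_congr_ae ?_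
  subst hc
  filter_upwards [Lp.coeFn_smul r a] with x hx
  simp only [hx, Pi.smul_apply, smul_eq_mul]
  ring

lemma IsTrace.zero {d : ℕ} {Ω : Set (Euc d)} : IsTrace Ω 0 0 := by
  have key : ∀ μ : Measure (Euc d), eLpNorm (fun x => 0 - (0 : Lp ℝ 2 μ) x) 2 μ = 0 := by
    intro μ
    rw [← eLpNorm_zero (ε := ℝ) (p := 2) (μ := μ)]
    refine eLpNorm_congr_ae ?_
    filter_upwards [Lp.coeFn_zero ℝ 2 μ] with x hx
    rw [hx]
    simp
  refine ⟨fun _ _ => 0, fun _ => contDiff_const, ?_, fun i => ?_, ?_⟩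
  · exact tendsto_const_nhds.congr fun k => (key _).symm
  · refine tendsto_const_nhds.congr fun k => ?_
    simp only [pderiv, fderiv_fun_const, Pi.zero_apply, zero_apply]
    exact (key _).symm
  · exact tendsto_const_nhds.congr fun k => (key _).symm

lemma IsTrace.add {d : ℕ} {Ω : Set (Euc d)} {u v : H2 Ω} {g h : Lp ℝ 2 (surfaceMeasure Ω)}
    (hu : IsTrace Ω u g) (hv : IsTrace Ω v h) : IsTrace Ω (u + v) (g + h) := by
  obtain ⟨φ, hφ, h1, h2, h3⟩ := hu
  obtain ⟨ψ, hψ, k1, k2, k3⟩ := hv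
  refine ⟨fun k x => φ k x + ψ k x, fun k => (hφ k).add (hψ k), ?_, fun i => ?_, ?_⟩
  · exact tendsto_eLpNorm_add (fun k => (hφ k).continuous)
      (fun k => (hψ k).continuous) h1 k1 rfl
  · have e : ∀ k x, pderiv i (fun x => φ k x + ψ k x) x = pderiv i (φ k) x + pderiv i (ψ k) x := by
      intro k x
      simp only [pderiv]
      rw [fderiv_fun_add ((hφ k).differentiable (by simp) x) ((hψ k).differentiable (by simp) x)]
      rfl
    simp only [e]
    exact tendsto_eLpNorm_add (fun k => continuous_pderiv i (hφ k))
      (fun k => continuous_pderiv i (hψ k)) (h2 i) (k2 i) rfl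
  · exact tendsto_eLpNorm_add (fun k => (hφ k).continuous)
      (fun k => (hψ k).continuous) h3 k3 rfl

lemma IsTrace.smul {d : ℕ} {Ω : Set (Euc d)} {u : H2 Ω} {g : Lp ℝ 2 (surfaceMeasure Ω)}
    (r : ℝ) (hu : IsTrace Ω u g) : IsTrace Ω (r • u) (r • g) := by
  obtain ⟨φ, hφ, h1, h2, h3⟩ := hu
  refine ⟨fun k x => r * φ k x, fun k => contDiff_const.mul (hφ k), ?_, fun i => ?_, ?_⟩
  · exact tendsto_eLpNorm_smul r h1 rfl
  · have e : ∀ k x, pderiv i (fun x => r * φ k x) x = r * pderiv i (φ k) x := by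
      intro k x
      simp only [pderiv]
      rw [fderiv_const_mul ((hφ k).differentiable (by simp) x)]
      rfl
    simp only [e]
    exact tendsto_eLpNorm_smul r (h2 i) rfl
  · exact tendsto_eLpNorm_smul r h3 rfl

/-- The Hilbert space `H²(Ω)^N`, with `‖u‖² = ∑_m ‖u_m‖²`. -/
abbrev H2Vec {d : ℕ} (Ω : Set (Euc d)) (N : ℕ) : Type := PiLp 2 (fun _ : Fin N => H2 Ω)

/-- The subspace `{u ∈ H²(Ω)^N : u|_∂Ω = 0}`. -/
def zeroTraceSpace {d : ℕ} (Ω : Set (Euc d)) (N : ℕ) : Submodule ℝ (H2Vec Ω N) where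
  carrier := {u | ∀ m, IsTrace Ω (u m) 0}
  zero_mem' := fun _ => IsTrace.zero
  add_mem' := fun hu hv m => by simpa using (hu m).add (hv m)
  smul_mem' := fun r _ hu m => by simpa using (hu m).smul r

/-! ### The quasi-reversibility functional -/

/-- `Lu = Δu + b · ∇u + c u`, for `u ∈ H²(Ω)`. -/
def ellipticOp {d : ℕ} {Ω : Set (Euc d)} (b : Euc d → Euc d) (c : Euc d → ℝ) (u : H2 Ω)
    (x : Euc d) : ℝ :=
  (∑ i, sobHess u i i x) + (∑ i, b x i * sobGrad u i x) + c x * sobFn u x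

/-- `s_mn(x) = ∫_0^T (A(x) ψ_n''(t) + a(x) ψ_n'(t)) ψ_m(t) dt`. -/
def couplingCoeff {d : ℕ} (A a : Euc d → ℝ) (T : ℝ) (ψ : ℕ → ℝ → ℝ) (m n : ℕ) (x : Euc d) : ℝ :=
  ∫ t in (0)..T, (A x * iteratedDerivWithin 2 (ψ n) (Icc 0 T) t +
    a x * derivWithin (ψ n) (Icc 0 T) t) * ψ m t

/-- The boundary mismatch `∫_∂Ω |∂_ν u - F|² dσ`. On a smooth bounded domain every `u ∈ H²(Ω)` has
exactly one normal derivative in `L²(∂Ω)` (trace theorem), so the infimum is over one element `g`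
and equals the integral evaluated at `g = ∂_ν u`. -/
def normalMismatch {d : ℕ} (Ω : Set (Euc d)) (u : H2 Ω) (F : Euc d → ℝ) : ℝ≥0∞ :=
  ⨅ (g : Lp ℝ 2 (surfaceMeasure Ω)) (_ : IsNormalDeriv Ω u g),
    ∫⁻ x, ‖g x - F x‖ₑ ^ 2 ∂(surfaceMeasure Ω)

/-- The functional
`J(u) = ∑_m ∫_Ω |L u_m - ∑_n s_mn u_n|² + ∑_m ∫_∂Ω |∂_ν u_m - ∫_0^T f(·,t) ψ_m(t) dt|² dσ + ε ‖u‖²`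
on `H²(Ω)^N`, with values in `[0, ∞]`. -/
def quasiRevFunctional {d : ℕ} (Ω : Set (Euc d)) (A a : Euc d → ℝ) (b : Euc d → Euc d)
    (c : Euc d → ℝ) (T : ℝ) (ψ : ℕ → ℝ → ℝ) (f : Euc d → ℝ → ℝ) (ε : ℝ) (N : ℕ)
    (u : H2Vec Ω N) : ℝ≥0∞ :=
  (∑ m : Fin N, ∫⁻ x in Ω, ‖ellipticOp b c (u m) x -
      ∑ n : Fin N, couplingCoeff A a T ψ m n x * sobFn (u n) x‖ₑ ^ 2) +
    (∑ m : Fin N, normalMismatch Ω (u m) (fun x => ∫ t in (0)..T, f x t * ψ m t)) +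
    ENNReal.ofReal (ε * ‖u‖ ^ 2)

end

noncomputable section

/-! ### The outer normal is continuous on the boundary -/

/-! The functional is a squared distance in disguise. Pair each `u` of zero trace with `y = (w, g)`,
where `w` is an L² representative of the interior residual and `g` a normal derivative of `u`. These
pairs form a subspace `Z` of a product of Hilbert spaces (`residualGraph`), and `J u` is the least
value of `‖y - y₀‖² + ε‖u‖²` over the `y` lying above `u`, or `⊤` if there is none; here `y₀ = (0,
boundary data)`. If `Z` is closed, minimizing `J` amounts to projecting `(0, y₀)` onto `Z` in the
norm weighted by `ε`. Pythagoras bounds the excess cost of a competitor below by `ε` times the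
squared distance of the `u`-components, which gives uniqueness (`existsUnique_minimizer_of_graph`).

The work lies in closedness. The residual need not be bounded on H², since `A` is only C¹ in the
open set; but it is a pointwise linear combination of jets, so a.e. convergence along a subsequence
identifies limits (`systemResidual_of_tendsto`). Traces and normal derivatives are closures of
relations on smooth functions, so a diagonal sequence suffices (`IsApprox.of_tendsto`). No trace
theorem enters: the normal derivative is treated as a possibly multivalued, partially defined linear
relation, and the infimum in the mismatch is attained because its fibres are closed and convex. -/

lemma IsLocalDefiningFunction.eq_zero {d : ℕ} {Ω : Set (Euc d)} (hΩ : IsOpen Ω) {x : Euc d}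
    (hx : x ∈ frontier Ω) {ρ : Euc d → ℝ} (h : IsLocalDefiningFunction Ω x ρ) : ρ x = 0 := by
  have hcont : ContinuousAt ρ x := h.contDiff.continuous.continuousAt
  rw [hΩ.frontier_eq] at hx
  refine le_antisymm ?_ (not_lt.1 fun hlt => hx.2 (h.eventually_mem_iff.self_of_nhds.2 hlt))
  by_contra! hpos
  have hev : ∀ᶠ y in 𝓝 x, y ∉ Ω := by
    filter_upwards [h.eventually_mem_iff, hcont.eventually_const_lt hpos] with y h1 h2 h3
    exact absurd (h1.1 h3) (not_lt.2 h2.le)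
  exact (mem_closure_iff_frequently.1 hx.1) hev

/-- Otherwise a short step from `x` along `v` would land inside `Ω` according to `ρ` and outside
according to `ρ'`. -/
lemma IsLocalDefiningFunction.inner_gradient_nonpos {d : ℕ} {Ω : Set (Euc d)} (hΩ : IsOpen Ω)
    {x : Euc d} (hx : x ∈ frontier Ω) {ρ ρ' : Euc d → ℝ} (h : IsLocalDefiningFunction Ω x ρ)
    (h' : IsLocalDefiningFunction Ω x ρ') {v : Euc d} (hv : inner ℝ (∇ ρ x) v < 0) :
    inner ℝ (∇ ρ' x) v ≤ 0 := by
  have line : ∀ {r : Euc d → ℝ}, IsLocalDefiningFunction Ω x r →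
      HasDerivAt (fun t : ℝ => r (x + t • v)) (inner ℝ (∇ r x) v) 0 := by
    intro r hr
    have h1 : HasFDerivAt r (fderiv ℝ r x) (x + (0 : ℝ) • v) := by
      simpa using (hr.contDiff.differentiable (by simp) x).hasFDerivAt
    have h2 : HasDerivAt (fun t : ℝ => x + t • v) v 0 := by
      simpa using ((hasDerivAt_id (0 : ℝ)).smul_const v).const_add x
    rw [inner_gradient_left]
    exact h1.comp_hasDerivAt 0 h2
  by_contra! hpos
  have htend : Tendsto (fun t : ℝ => x + t • v) (𝓝[>] 0) (𝓝 x) := by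
    have : Continuous fun t : ℝ => x + t • v := by fun_prop
    simpa using (this.tendsto 0).mono_left nhdsWithin_le_nhds
  have slopeNeg : ∀ᶠ t in 𝓝[>] (0 : ℝ), ρ (x + t • v) < 0 := by
    have := (hasDerivAt_iff_tendsto_slope.1 (line h)).mono_left
      (nhdsWithin_mono (0 : ℝ) (fun t (ht : 0 < t) => ht.ne'))
    filter_upwards [this.eventually_lt_const hv, self_mem_nhdsWithin] with t ht (ht0 : 0 < t)
    rw [slope_def_field] at ht
    simp only [zero_smul, add_zero, h.eq_zero hΩ hx, sub_zero] at ht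
    exact (div_neg_iff.1 ht).elim (fun h => absurd h.2 (not_lt.2 ht0.le)) (fun h => h.1)
  have slopePos : ∀ᶠ t in 𝓝[>] (0 : ℝ), 0 < ρ' (x + t • v) := by
    have := (hasDerivAt_iff_tendsto_slope.1 (line h')).mono_left
      (nhdsWithin_mono (0 : ℝ) (fun t (ht : 0 < t) => ht.ne'))
    filter_upwards [this.eventually_const_lt hpos, self_mem_nhdsWithin] with t ht (ht0 : 0 < t)
    rw [slope_def_field] at ht
    simp only [zero_smul, add_zero, h'.eq_zero hΩ hx, sub_zero] at ht
    exact (div_pos_iff_of_pos_right ht0).1 ht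
  obtain ⟨t, h1, h2, h3, h4⟩ := (slopeNeg.and (slopePos.and
    ((htend.eventually h.eventually_mem_iff).and
      (htend.eventually h'.eventually_mem_iff)))).exists
  exact absurd (h4.1 (h3.2 h1)) (not_lt.2 h2.le)

lemma IsLocalDefiningFunction.normalized_gradient_eq {d : ℕ} {Ω : Set (Euc d)} (hΩ : IsOpen Ω)
    {x : Euc d} (hx : x ∈ frontier Ω) {ρ ρ' : Euc d → ℝ} (h : IsLocalDefiningFunction Ω x ρ)
    (h' : IsLocalDefiningFunction Ω x ρ') :
    ‖∇ ρ x‖⁻¹ • ∇ ρ x = ‖∇ ρ' x‖⁻¹ • ∇ ρ' x := by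
  set p := ∇ ρ x with hp
  set q := ∇ ρ' x with hq
  have hp0 : 0 < ‖p‖ := norm_pos_iff.2 h.gradient_ne_zero
  have hq0 : 0 < ‖q‖ := norm_pos_iff.2 h'.gradient_ne_zero
  set n := ‖p‖⁻¹ • p with hn
  set m := ‖q‖⁻¹ • q with hm
  have hn1 : ‖n‖ = 1 := norm_smul_inv_norm h.gradient_ne_zero
  have hm1 : ‖m‖ = 1 := norm_smul_inv_norm h'.gradient_ne_zero
  have hpn : p = ‖p‖ • n := by rw [hn, smul_smul, mul_inv_cancel₀ hp0.ne', one_smul]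
  have hqm : q = ‖q‖ • m := by rw [hm, smul_smul, mul_inv_cancel₀ hq0.ne', one_smul]
  by_contra hne
  -- Distinct unit vectors have inner product below 1, so the direction `m - n` decreases `ρ` and
  -- increases `ρ'` to first order.
  have hlt : inner ℝ n m < 1 := (inner_lt_one_iff_real_of_norm_eq_one hn1 hm1).2 hne
  have h1 : inner ℝ p (m - n) < 0 := by
    rw [hpn, real_inner_smul_left, inner_sub_right, real_inner_self_eq_norm_sq, hn1]
    exact mul_neg_of_pos_of_neg hp0 (by linarith)
  have h2 : 0 < inner ℝ q (m - n) := by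
    rw [hqm, real_inner_smul_left, inner_sub_right, real_inner_self_eq_norm_sq, hm1,
      real_inner_comm]
    exact mul_pos hq0 (by linarith)
  exact absurd (h.inner_gradient_nonpos hΩ hx h' h1) (not_le.2 h2)

lemma IsLocalDefiningFunction.outerNormal_eq {d : ℕ} {Ω : Set (Euc d)} (hΩ : IsOpen Ω)
    {x : Euc d} (hx : x ∈ frontier Ω) {ρ : Euc d → ℝ} (h : IsLocalDefiningFunction Ω x ρ) :
    outerNormal Ω x = ‖∇ ρ x‖⁻¹ • ∇ ρ x := by
  have hex : ∃ ρ, IsLocalDefiningFunction Ω x ρ := ⟨ρ, h⟩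
  rw [outerNormal, dif_pos hex]
  exact hex.choose_spec.normalized_gradient_eq hΩ hx h

lemma continuous_gradient {d : ℕ} {ρ : Euc d → ℝ} (h : ContDiff ℝ ∞ ρ) :
    Continuous (∇ ρ) := by
  unfold gradient
  exact (LinearIsometryEquiv.continuous _).comp (h.continuous_fderiv (by simp))

/-- `outerNormal` chooses a defining function separately at each point. Being a defining function is
an open condition, so one `ρ` serves all nearby boundary points, and independence of the choice
gives a continuous local formula. -/
lemma IsSmoothBoundedDomain.continuousOn_outerNormal {d : ℕ} {Ω : Set (Euc d)}
    (hΩ : IsSmoothBoundedDomain Ω) : ContinuousOn (outerNormal Ω) (frontier Ω) := by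
  intro x hx
  obtain ⟨ρ, hρ⟩ := hΩ.smooth_boundary x hx
  have hgrad := continuous_gradient hρ.contDiff
  have hc : ContinuousAt (fun y => ‖∇ ρ y‖⁻¹ • ∇ ρ y) x :=
    (hgrad.continuousAt.norm.inv₀ (norm_ne_zero_iff.2 hρ.gradient_ne_zero)).smul
      hgrad.continuousAt
  refine hc.continuousWithinAt.congr_of_eventuallyEq ?_ (hρ.outerNormal_eq hΩ.isOpen hx)
  filter_upwards [self_mem_nhdsWithin, nhdsWithin_le_nhds hρ.eventually_mem_iff.eventually_nhds,
    nhdsWithin_le_nhds (hgrad.continuousAt.eventually_ne hρ.gradient_ne_zero)] with y hy h1 h2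
  exact IsLocalDefiningFunction.outerNormal_eq hΩ.isOpen hy ⟨hρ.contDiff, h2, h1⟩

/-- Needed for the triangle inequality of `eLpNorm` in the limit and sum arguments for normal
derivatives. -/
lemma IsSmoothBoundedDomain.aestronglyMeasurable_normalDeriv {d : ℕ} {Ω : Set (Euc d)}
    (hΩ : IsSmoothBoundedDomain Ω) {φ : Euc d → ℝ} (hφ : ContDiff ℝ ∞ φ) :
    AEStronglyMeasurable (fun x => fderiv ℝ φ x (outerNormal Ω x)) (surfaceMeasure Ω) := by
  refine ContinuousOn.aestronglyMeasurable ?_ isClosed_frontier.measurableSet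
  exact (hφ.continuous_fderiv (by simp)).continuousOn.clm_apply hΩ.continuousOn_outerNormal

/-! ### Measurability and integrability of the data -/

lemma aestronglyMeasurable_couplingCoeff {d : ℕ} {μ : Measure (Euc d)} {A a : Euc d → ℝ}
    (hA : AEStronglyMeasurable A μ) (ha : AEStronglyMeasurable a μ) {T : ℝ} (hT : 0 < T)
    {ψ : ℕ → ℝ → ℝ} (hψ : ∀ n, ContDiffOn ℝ 2 (ψ n) (Icc 0 T)) (m n : ℕ) :
    AEStronglyMeasurable (couplingCoeff A a T ψ m n) μ := by
  have hu : uIcc 0 T = Icc 0 T := uIcc_of_le hT.le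
  have h2 : IntervalIntegrable
      (fun t => iteratedDerivWithin 2 (ψ n) (Icc 0 T) t * ψ m t) volume 0 T := by
    refine ContinuousOn.intervalIntegrable ?_
    rw [hu]
    exact ((hψ n).continuousOn_iteratedDerivWithin (by norm_num)
      (uniqueDiffOn_Icc hT)).mul (hψ m).continuousOn
  have h1 : IntervalIntegrable
      (fun t => derivWithin (ψ n) (Icc 0 T) t * ψ m t) volume 0 T := by
    refine ContinuousOn.intervalIntegrable ?_
    rw [hu]
    exact ((hψ n).continuousOn_derivWithin (uniqueDiffOn_Icc hT) (by norm_num)).mul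
      (hψ m).continuousOn
  -- The variables separate: the coefficient is `A` and `a` combined with constants depending only
  -- on `m` and `n`.
  have e : couplingCoeff A a T ψ m n = fun x =>
      A x * (∫ t in (0)..T, iteratedDerivWithin 2 (ψ n) (Icc 0 T) t * ψ m t) +
        a x * ∫ t in (0)..T, derivWithin (ψ n) (Icc 0 T) t * ψ m t := by
    funext x
    rw [← intervalIntegral.integral_const_mul, ← intervalIntegral.integral_const_mul,
      ← intervalIntegral.integral_add (h2.const_mul _) (h1.const_mul _), couplingCoeff]
    refine intervalIntegral.integral_congr fun t _ => ?_
    ring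
  rw [e]
  exact (hA.mul_const _).add (ha.mul_const _)

lemma memLp_two_iff_lintegral {α : Type*} [MeasurableSpace α] {μ : Measure α} {g : α → ℝ} :
    MemLp g 2 μ ↔ AEStronglyMeasurable g μ ∧ ∫⁻ x, ‖g x‖ₑ ^ 2 ∂μ < ⊤ := by
  have h := eLpNorm_nnreal_pow_eq_lintegral (f := g) (μ := μ) (p := 2) (by norm_num)
  norm_num at h
  rw [MemLp, ← h]
  simp

lemma enorm_sq_eq_lintegral {α : Type*} [MeasurableSpace α] {μ : Measure α} (g : Lp ℝ 2 μ) :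
    ‖g‖ₑ ^ 2 = ∫⁻ x, ‖g x‖ₑ ^ 2 ∂μ := by
  have h := eLpNorm_nnreal_pow_eq_lintegral (f := g) (μ := μ) (p := 2) (by norm_num)
  norm_num at h
  rw [Lp.enorm_def, h]

/-- Cauchy–Schwarz in `t`, then Tonelli. -/
lemma memLp_integral_mul {α β : Type*} [MeasurableSpace α] [MeasurableSpace β]
    {μ : Measure α} {ν : Measure β} [SFinite ν] {f : α → β → ℝ}
    (hf : MemLp (Function.uncurry f) 2 (μ.prod ν)) {g : β → ℝ} (hg : MemLp g 2 ν) :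
    MemLp (fun x => ∫ t, f x t * g t ∂ν) 2 μ := by
  have hfm := hf.1
  -- A genuinely measurable representative composes with the second projection without any
  -- s-finiteness of `μ`.
  obtain ⟨g', hg'm, hgg'⟩ := hg.1
  have hcongr : (fun x => ∫ t, f x t * g t ∂ν) = fun x => ∫ t, f x t * g' t ∂ν := by
    funext x
    refine integral_congr_ae ?_
    filter_upwards [hgg'] with t ht
    rw [ht]
  have hg' : MemLp g' 2 ν := (memLp_congr_ae hgg').1 hg
  rw [hcongr, memLp_two_iff_lintegral]
  refine ⟨AEStronglyMeasurable.integral_prod_right' (f := fun z : α × β => f z.1 z.2 * g' z.2)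
    (hfm.mul (hg'm.comp_measurable measurable_snd).aestronglyMeasurable), ?_⟩
  have hC : ∫⁻ t, ‖g' t‖ₑ ^ 2 ∂ν < ⊤ := (memLp_two_iff_lintegral.1 hg').2
  have hI : ∫⁻ x, ∫⁻ t, ‖f x t‖ₑ ^ 2 ∂ν ∂μ < ⊤ := by
    have := (memLp_two_iff_lintegral.1 hf).2
    rwa [lintegral_prod _ (hfm.enorm.pow_const 2)] at this
  have hbound : ∀ᵐ x ∂μ, ‖∫ t, f x t * g' t ∂ν‖ₑ ^ 2 ≤
      (∫⁻ t, ‖f x t‖ₑ ^ 2 ∂ν) * ∫⁻ t, ‖g' t‖ₑ ^ 2 ∂ν := by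
    filter_upwards [hfm.prodMk_left] with x hx
    have h1 : ‖∫ t, f x t * g' t ∂ν‖ₑ ≤ ∫⁻ t, ‖f x t‖ₑ * ‖g' t‖ₑ ∂ν := by
      refine (enorm_integral_le_lintegral_enorm _).trans_eq ?_
      simp only [enorm_mul]
    have h2 := ENNReal.lintegral_mul_le_Lp_mul_Lq ν Real.HolderConjugate.two_two
      hx.enorm hg'm.aestronglyMeasurable.enorm
    have h3 := pow_le_pow_left' (h1.trans h2) 2
    refine h3.trans_eq ?_
    rw [mul_pow, ← ENNReal.rpow_natCast, ← ENNReal.rpow_natCast, ← ENNReal.rpow_mul,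
      ← ENNReal.rpow_mul]
    norm_num
  refine (lintegral_mono_ae hbound).trans_lt ?_
  rw [lintegral_mul_const' _ _ hC.ne]
  exact ENNReal.mul_lt_top hI hC

lemma memLp_boundaryData {d : ℕ} {Ω : Set (Euc d)} {T : ℝ} (hT : 0 < T) {f : Euc d → ℝ → ℝ}
    (hf : MemLp (Function.uncurry f) 2
      ((surfaceMeasure Ω).prod (volume.restrict (Set.Ioo 0 T))))
    {ψ : ℝ → ℝ} (hψ : ContinuousOn ψ (Icc 0 T)) :
    MemLp (fun x => ∫ t in (0)..T, f x t * ψ t) 2 (surfaceMeasure Ω) := by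
  have hψ2 : MemLp ψ 2 (volume.restrict (Ioo 0 T)) := by
    obtain ⟨M, hM⟩ := isCompact_Icc.exists_bound_of_continuousOn hψ
    refine MemLp.of_bound
      ((hψ.mono Ioo_subset_Icc_self).aestronglyMeasurable measurableSet_Ioo) M ?_
    filter_upwards [ae_restrict_mem measurableSet_Ioo] with t ht
    exact hM t (Ioo_subset_Icc_self ht)
  have := memLp_integral_mul hf hψ2
  simpa only [intervalIntegral.integral_of_le hT.le, integral_Ioc_eq_integral_Ioo] using this

/-! ### Limits of approximable families -/

/-- A family `v` of functions is `L²`-approximated by the elements of `S` through the maps `D`. -/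
def IsApprox {ι α Φ : Type*} [MeasurableSpace α] (μ : ι → Measure α) (S : Φ → Prop)
    (D : ι → Φ → α → ℝ) (v : ι → α → ℝ) : Prop :=
  ∃ φ : ℕ → Φ, (∀ k, S (φ k)) ∧
    ∀ i, Tendsto (fun k => eLpNorm (fun x => D i (φ k) x - v i x) 2 (μ i)) atTop (𝓝 0)

/-- Diagonal argument: for each `n` take some `v k` within `1/n` of `w`, then an approximant within
`1/n` of `v k`. Finiteness of `ι` lets one `k` and one approximant serve all components. At `n = 0`
the bound is `⊤`. -/
lemma IsApprox.of_tendsto {ι α Φ : Type*} [Finite ι] [MeasurableSpace α] {μ : ι → Measure α}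
    {S : Φ → Prop} {D : ι → Φ → α → ℝ} (hD : ∀ i, ∀ φ, S φ → AEStronglyMeasurable (D i φ) (μ i))
    {v : ℕ → ι → α → ℝ} {w : ι → α → ℝ} (hvm : ∀ k i, AEStronglyMeasurable (v k i) (μ i))
    (hwm : ∀ i, AEStronglyMeasurable (w i) (μ i)) (hv : ∀ k, IsApprox μ S D (v k))
    (hlim : ∀ i, Tendsto (fun k => eLpNorm (fun x => v k i x - w i x) 2 (μ i)) atTop (𝓝 0)) :
    IsApprox μ S D w := by
  have key : ∀ n : ℕ, ∃ φ, S φ ∧ ∀ i,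
      eLpNorm (fun x => D i φ x - w i x) 2 (μ i) ≤ (n : ℝ≥0∞)⁻¹ + (n : ℝ≥0∞)⁻¹ := by
    intro n
    have hn : (0 : ℝ≥0∞) < (n : ℝ≥0∞)⁻¹ := ENNReal.inv_pos.2 (ENNReal.natCast_ne_top n)
    obtain ⟨k, hk⟩ := (eventually_all.2 fun i => (hlim i).eventually_le_const hn).exists
    obtain ⟨φ, hφ, hφlim⟩ := hv k
    obtain ⟨j, hj⟩ := (eventually_all.2 fun i => (hφlim i).eventually_le_const hn).exists
    refine ⟨φ j, hφ j, fun i => ?_⟩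
    have hadd := eLpNorm_add_le (p := 2) ((hD i _ (hφ j)).sub (hvm k i))
      ((hvm k i).sub (hwm i)) (by norm_num)
    rw [sub_add_sub_cancel] at hadd
    exact hadd.trans (add_le_add (hj i) (hk i))
  choose φ hφ hle using key
  refine ⟨φ, hφ, fun i => tendsto_of_tendsto_of_tendsto_of_le_of_le tendsto_const_nhds ?_
    (fun _ => zero_le) (fun n => hle n i)⟩
  simpa using ENNReal.tendsto_inv_nat_nhds_zero.add ENNReal.tendsto_inv_nat_nhds_zero

lemma tendsto_eLpNorm_sub {α β : Type*} [MeasurableSpace α] {μ : Measure α} {l : Filter β}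
    {v : β → Lp ℝ 2 μ} {w : Lp ℝ 2 μ} (h : Tendsto v l (𝓝 w)) :
    Tendsto (fun k => eLpNorm (fun x => v k x - w x) 2 μ) l (𝓝 0) :=
  (Lp.tendsto_Lp_iff_tendsto_eLpNorm' v w).1 h

/-- Measures indexing the data of a trace: `Ω` for volume data, `∂Ω` for boundary data. -/
def dataMeasure {d : ℕ} (Ω : Set (Euc d)) (κ : Type*) : κ ⊕ Unit → Measure (Euc d) :=
  Sum.elim (fun _ => volume.restrict Ω) (fun _ => surfaceMeasure Ω)

lemma continuous_jet {d : ℕ} {Ω : Set (Euc d)} (j : DerivIdx d) :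
    Continuous fun u : H2 Ω => u.1 j :=
  (PiLp.proj 2 (fun _ : DerivIdx d => L2 Ω) (𝕜 := ℝ) j).continuous.comp continuous_subtype_val

/-- Puts traces in the common form `IsApprox`, so that the diagonal argument proved there applies to
them and to normal derivatives alike. -/
lemma isTrace_iff {d : ℕ} {Ω : Set (Euc d)} {u : H2 Ω} {g : Lp ℝ 2 (surfaceMeasure Ω)} :
    IsTrace Ω u g ↔ IsApprox (dataMeasure Ω (Unit ⊕ Fin d)) (ContDiff ℝ ∞)
      (Sum.elim (Sum.elim (fun _ φ => φ) (fun i φ => pderiv i φ)) (fun _ φ => φ))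
      (Sum.elim (Sum.elim (fun _ => sobFn u) (fun i => sobGrad u i)) (fun _ => g)) := by
  simp only [IsTrace, IsApprox, Sum.forall, dataMeasure, Sum.elim_inl, Sum.elim_inr,
    forall_const, and_assoc]

lemma isNormalDeriv_iff {d : ℕ} {Ω : Set (Euc d)} {u : H2 Ω} {g : Lp ℝ 2 (surfaceMeasure Ω)} :
    IsNormalDeriv Ω u g ↔ IsApprox (dataMeasure Ω (DerivIdx d)) (ContDiff ℝ ∞)
      (Sum.elim (Sum.elim (fun _ φ => φ) (Sum.elim (fun i φ => pderiv i φ)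
        (fun p φ => pderiv p.2 (pderiv p.1 φ)))) (fun _ φ x => fderiv ℝ φ x (outerNormal Ω x)))
      (Sum.elim (fun j => u.1 j) (fun _ => g)) := by
  simp only [IsNormalDeriv, IsApprox, Sum.forall, dataMeasure, Sum.elim_inl, Sum.elim_inr,
    forall_const, and_assoc, Prod.forall, Unique.forall_iff, PUnit.default_eq_unit, sobFn, sobGrad, sobHess]

lemma contDiff_pderiv {d : ℕ} (i : Fin d) {φ : Euc d → ℝ} (hφ : ContDiff ℝ ∞ φ) :
    ContDiff ℝ ∞ (pderiv i φ) :=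
  (hφ.fderiv_right (m := ∞) (by simp)).clm_apply contDiff_const

lemma IsTrace.of_tendsto {d : ℕ} {Ω : Set (Euc d)} {u : ℕ → H2 Ω} {u' : H2 Ω}
    {g : ℕ → Lp ℝ 2 (surfaceMeasure Ω)} {g' : Lp ℝ 2 (surfaceMeasure Ω)}
    (hu : Tendsto u atTop (𝓝 u')) (hg : Tendsto g atTop (𝓝 g'))
    (h : ∀ k, IsTrace Ω (u k) (g k)) : IsTrace Ω u' g' := by
  refine isTrace_iff.2 (IsApprox.of_tendsto ?_ ?_ ?_ (fun k => isTrace_iff.1 (h k)) ?_)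
  · rintro ((_ | i) | _) φ hφ
    · exact hφ.continuous.aestronglyMeasurable
    · exact (continuous_pderiv i hφ).aestronglyMeasurable
    · exact hφ.continuous.aestronglyMeasurable
  · rintro k ((_ | i) | _) <;> exact Lp.aestronglyMeasurable _
  · rintro ((_ | i) | _) <;> exact Lp.aestronglyMeasurable _
  · rintro ((_ | i) | _)
    · exact tendsto_eLpNorm_sub (((continuous_jet (.inl ())).tendsto u').comp hu)
    · exact tendsto_eLpNorm_sub (((continuous_jet (.inr (.inl i))).tendsto u').comp hu)
    · exact tendsto_eLpNorm_sub hg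

lemma IsNormalDeriv.of_tendsto {d : ℕ} {Ω : Set (Euc d)} (hΩ : IsSmoothBoundedDomain Ω)
    {u : ℕ → H2 Ω} {u' : H2 Ω}
    {g : ℕ → Lp ℝ 2 (surfaceMeasure Ω)} {g' : Lp ℝ 2 (surfaceMeasure Ω)}
    (hu : Tendsto u atTop (𝓝 u')) (hg : Tendsto g atTop (𝓝 g'))
    (h : ∀ k, IsNormalDeriv Ω (u k) (g k)) : IsNormalDeriv Ω u' g' := by
  refine isNormalDeriv_iff.2 (IsApprox.of_tendsto ?_ ?_ ?_ (fun k => isNormalDeriv_iff.1 (h k)) ?_)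
  · rintro ((_ | i | p) | _) φ hφ
    · exact hφ.continuous.aestronglyMeasurable
    · exact (continuous_pderiv i hφ).aestronglyMeasurable
    · exact (continuous_pderiv p.2 (contDiff_pderiv p.1 hφ)).aestronglyMeasurable
    · exact hΩ.aestronglyMeasurable_normalDeriv hφ
  · rintro k (j | _) <;> exact Lp.aestronglyMeasurable _
  · rintro (j | _) <;> exact Lp.aestronglyMeasurable _
  · rintro (j | _)
    · exact tendsto_eLpNorm_sub (((continuous_jet j).tendsto u').comp hu)
    · exact tendsto_eLpNorm_sub hg

/-! ### Linearity of the normal derivative -/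

lemma IsApprox.add {ι α Φ : Type*} [MeasurableSpace α] [AddCommGroup Φ] {μ : ι → Measure α}
    {S : Φ → Prop} {D : ι → Φ → α → ℝ} (hD : ∀ i, ∀ φ, S φ → AEStronglyMeasurable (D i φ) (μ i))
    (hS : ∀ φ, S φ → ∀ χ, S χ → S (φ + χ))
    (hadd : ∀ i, ∀ φ, S φ → ∀ χ, S χ → D i (φ + χ) = D i φ + D i χ)
    {v w z : ι → α → ℝ} (hvm : ∀ i, AEStronglyMeasurable (v i) (μ i))
    (hwm : ∀ i, AEStronglyMeasurable (w i) (μ i)) (hz : ∀ i, z i =ᵐ[μ i] v i + w i)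
    (hv : IsApprox μ S D v) (hw : IsApprox μ S D w) : IsApprox μ S D z := by
  obtain ⟨φ, hφ, hφl⟩ := hv
  obtain ⟨χ, hχ, hχl⟩ := hw
  refine ⟨fun k => φ k + χ k, fun k => hS _ (hφ k) _ (hχ k), fun i =>
    tendsto_of_tendsto_of_tendsto_of_le_of_le tendsto_const_nhds
      (by simpa using (hφl i).add (hχl i)) (fun _ => zero_le) fun k => ?_⟩
  refine le_trans (le_of_eq (eLpNorm_congr_ae ?_)) (eLpNorm_add_le
    ((hD i _ (hφ k)).sub (hvm i)) ((hD i _ (hχ k)).sub (hwm i)) (by norm_num))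
  filter_upwards [hz i] with x hx
  simp only [hx, hadd i _ (hφ k) _ (hχ k), Pi.add_apply]
  ring

lemma IsApprox.smul {ι α Φ : Type*} [MeasurableSpace α] [AddCommGroup Φ] [Module ℝ Φ]
    {μ : ι → Measure α} {S : Φ → Prop} {D : ι → Φ → α → ℝ} (r : ℝ)
    (hS : ∀ φ, S φ → S (r • φ)) (hsmul : ∀ i, ∀ φ, S φ → D i (r • φ) = r • D i φ)
    {v z : ι → α → ℝ} (hz : ∀ i, z i =ᵐ[μ i] r • v i)
    (hv : IsApprox μ S D v) : IsApprox μ S D z := by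
  obtain ⟨φ, hφ, hφl⟩ := hv
  refine ⟨fun k => r • φ k, fun k => hS _ (hφ k), fun i => ?_⟩
  have h₂ : Tendsto (fun k => ‖r‖ₑ * eLpNorm (fun x => D i (φ k) x - v i x) 2 (μ i)) atTop
      (𝓝 0) := by
    simpa using ENNReal.Tendsto.const_mul (hφl i) (Or.inr (enorm_ne_top (x := r)))
  refine h₂.congr (fun k => ?_)
  rw [← eLpNorm_const_smul]
  refine eLpNorm_congr_ae ?_
  filter_upwards [hz i] with x hx
  simp only [hx, hsmul i _ (hφ k), Pi.smul_apply, smul_eq_mul]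
  ring

lemma fderiv_add_of_smooth {d : ℕ} {φ χ : Euc d → ℝ} (hφ : ContDiff ℝ ∞ φ)
    (hχ : ContDiff ℝ ∞ χ) (x : Euc d) : fderiv ℝ (φ + χ) x = fderiv ℝ φ x + fderiv ℝ χ x :=
  fderiv_add (hφ.differentiable (by simp) x) (hχ.differentiable (by simp) x)

lemma pderiv_add {d : ℕ} (i : Fin d) {φ χ : Euc d → ℝ} (hφ : ContDiff ℝ ∞ φ)
    (hχ : ContDiff ℝ ∞ χ) : pderiv i (φ + χ) = pderiv i φ + pderiv i χ := by
  funext x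
  simp [pderiv, fderiv_add_of_smooth hφ hχ]

lemma fderiv_smul_of_smooth {d : ℕ} (r : ℝ) {φ : Euc d → ℝ} (hφ : ContDiff ℝ ∞ φ) (x : Euc d) :
    fderiv ℝ (r • φ) x = r • fderiv ℝ φ x :=
  fderiv_const_smul (hφ.differentiable (by simp) x) r

lemma pderiv_smul {d : ℕ} (i : Fin d) (r : ℝ) {φ : Euc d → ℝ} (hφ : ContDiff ℝ ∞ φ) :
    pderiv i (r • φ) = r • pderiv i φ := by
  funext x
  simp [pderiv, fderiv_smul_of_smooth r hφ]

lemma IsNormalDeriv.add {d : ℕ} {Ω : Set (Euc d)} (hΩ : IsSmoothBoundedDomain Ω) {u v : H2 Ω}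
    {g h : Lp ℝ 2 (surfaceMeasure Ω)} (hu : IsNormalDeriv Ω u g) (hv : IsNormalDeriv Ω v h) :
    IsNormalDeriv Ω (u + v) (g + h) := by
  refine isNormalDeriv_iff.2 (IsApprox.add ?_ ?_ ?_ ?_ ?_ ?_
    (isNormalDeriv_iff.1 hu) (isNormalDeriv_iff.1 hv))
  · rintro ((_ | i | p) | _) φ hφ
    · exact hφ.continuous.aestronglyMeasurable
    · exact (continuous_pderiv i hφ).aestronglyMeasurable
    · exact (continuous_pderiv p.2 (contDiff_pderiv p.1 hφ)).aestronglyMeasurable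
    · exact hΩ.aestronglyMeasurable_normalDeriv hφ
  · exact fun φ hφ χ hχ => hφ.add hχ
  · rintro ((_ | i | p) | _) φ hφ χ hχ
    · rfl
    · exact pderiv_add i hφ hχ
    · simp only [Sum.elim_inl, Sum.elim_inr]
      rw [pderiv_add p.1 hφ hχ, pderiv_add p.2 (contDiff_pderiv _ hφ) (contDiff_pderiv _ hχ)]
    · funext x
      simp [fderiv_add_of_smooth hφ hχ]
  · rintro (j | _) <;> exact Lp.aestronglyMeasurable _
  · rintro (j | _) <;> exact Lp.aestronglyMeasurable _
  · rintro (j | _) <;> exact Lp.coeFn_add _ _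

lemma IsNormalDeriv.smul {d : ℕ} {Ω : Set (Euc d)} (r : ℝ) {u : H2 Ω}
    {g : Lp ℝ 2 (surfaceMeasure Ω)} (hu : IsNormalDeriv Ω u g) :
    IsNormalDeriv Ω (r • u) (r • g) := by
  refine isNormalDeriv_iff.2 (IsApprox.smul r ?_ ?_ ?_ (isNormalDeriv_iff.1 hu))
  · exact fun φ hφ => hφ.const_smul r
  · rintro ((_ | i | p) | _) φ hφ
    · rfl
    · exact pderiv_smul i r hφ
    · simp only [Sum.elim_inl, Sum.elim_inr]
      rw [pderiv_smul p.1 r hφ, pderiv_smul p.2 r (contDiff_pderiv _ hφ)]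
    · funext x
      simp [fderiv_smul_of_smooth r hφ]
  · rintro (j | _) <;> exact Lp.coeFn_smul _ _

lemma IsNormalDeriv.zero {d : ℕ} {Ω : Set (Euc d)} : IsNormalDeriv Ω 0 0 := by
  have key : ∀ μ : Measure (Euc d), eLpNorm (fun x => 0 - (0 : Lp ℝ 2 μ) x) 2 μ = 0 := by
    intro μ
    rw [← eLpNorm_zero (ε := ℝ) (p := 2) (μ := μ)]
    refine eLpNorm_congr_ae ?_
    filter_upwards [Lp.coeFn_zero ℝ 2 μ] with x hx
    rw [hx]
    simp
  have hp : ∀ i : Fin d, pderiv i (0 : Euc d → ℝ) = 0 := fun i => by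
    funext x
    simp [pderiv]
  refine isNormalDeriv_iff.2 ⟨fun _ => 0, fun _ => contDiff_const, ?_⟩
  rintro ((_ | i | p) | _) <;> refine tendsto_const_nhds.congr fun k => ?_
  · exact (key _).symm
  · simp only [Sum.elim_inl, Sum.elim_inr, hp]
    exact (key _).symm
  · simp only [Sum.elim_inl, Sum.elim_inr, hp]
    exact (key _).symm
  · simp only [Sum.elim_inr, fderiv_zero, Pi.zero_apply, zero_apply]
    exact (key _).symm

/-! ### Completeness of `H²(Ω)` -/

lemma continuous_integral_mul {d : ℕ} {Ω : Set (Euc d)} {φ : Euc d → ℝ}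
    (hφ : MemLp φ 2 (volume.restrict Ω)) :
    Continuous fun v : L2 Ω => ∫ x in Ω, v x * φ x := by
  have : (fun v : L2 Ω => ∫ x in Ω, v x * φ x) = fun v : L2 Ω => inner ℝ (hφ.toLp φ) v := by
    funext v
    rw [L2.inner_def]
    refine integral_congr_ae ?_
    filter_upwards [hφ.coeFn_toLp] with x hx
    simp [hx]
  rw [this]
  fun_prop

/-- Each test function imposes one equation between continuous linear functionals of the pair. -/
lemma isClosed_isWeakPartial {d : ℕ} {Ω : Set (Euc d)} (i : Fin d) :
    IsClosed {p : L2 Ω × L2 Ω | IsWeakPartial Ω i p.1 p.2} := by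
  simp only [IsWeakPartial, ofPred_forall]
  refine isClosed_iInter fun φ => isClosed_iInter fun hφ => isClosed_iInter fun hc =>
    isClosed_iInter fun _ => isClosed_eq ?_ ?_
  · exact (continuous_integral_mul (memLp_of_smooth Ω (continuous_pderiv i hφ)
      (hasCompactSupport_pderiv i hc))).comp continuous_fst
  · exact ((continuous_integral_mul (memLp_of_smooth Ω hφ.continuous hc)).comp
      continuous_snd).neg

lemma isClosed_H2 {d : ℕ} (Ω : Set (Euc d)) : IsClosed (H2 Ω : Set (Jets Ω)) := by
  have hproj : ∀ j, Continuous fun U : Jets Ω => U j := fun j =>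
    (PiLp.proj 2 (fun _ : DerivIdx d => L2 Ω) (𝕜 := ℝ) j).continuous
  have : (H2 Ω : Set (Jets Ω)) =
      (⋂ i, {U | IsWeakPartial Ω i (U (.inl ())) (U (.inr (.inl i)))}) ∩
        ⋂ i, ⋂ j, {U | IsWeakPartial Ω j (U (.inr (.inl i))) (U (.inr (.inr (i, j))))} := by
    ext U
    simp only [mem_inter_iff, mem_iInter, mem_ofPred_eq]
    rfl
  rw [this]
  exact (isClosed_iInter fun i => (isClosed_isWeakPartial i).preimage
      ((hproj (.inl ())).prodMk (hproj (.inr (.inl i))))).inter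
    (isClosed_iInter fun i => isClosed_iInter fun j => (isClosed_isWeakPartial j).preimage
      ((hproj (.inr (.inl i))).prodMk (hproj (.inr (.inr (i, j))))))

instance {d : ℕ} (Ω : Set (Euc d)) : CompleteSpace (H2 Ω) :=
  (isClosed_H2 Ω).completeSpace_coe

/-! ### Weighted projection onto a closed subspace of a product -/

/-- Scaling the first factor by `√ε` turns the objective into the squared distance to `(0, y)` in
the ℓ² product, so the orthogonal projection minimizes it. The extra term on the left is what
remains of Pythagoras. -/
lemma exists_minimizer_of_isClosed {U Y : Type*} [NormedAddCommGroup U] [InnerProductSpace ℝ U]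
    [CompleteSpace U] [NormedAddCommGroup Y] [InnerProductSpace ℝ Y] [CompleteSpace Y]
    (Z : Submodule ℝ (U × Y)) (hZ : IsClosed (Z : Set (U × Y))) (y : Y) {ε : ℝ} (hε : 0 < ε) :
    ∃ z ∈ Z, ∀ z' ∈ Z, (‖z.2 - y‖ ^ 2 + ε * ‖z.1‖ ^ 2) + ε * ‖z.1 - z'.1‖ ^ 2 ≤
      ‖z'.2 - y‖ ^ 2 + ε * ‖z'.1‖ ^ 2 := by
  have hs : √ε ≠ 0 := (Real.sqrt_pos.2 hε).ne'
  -- `e` undoes the scaling, so `K` below is the rescaled copy of `Z`.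
  let e : WithLp 2 (U × Y) →L[ℝ] U × Y :=
    ((√ε)⁻¹ • ContinuousLinearMap.id ℝ U).prodMap (ContinuousLinearMap.id ℝ Y) ∘L
      (WithLp.prodContinuousLinearEquiv 2 ℝ U Y : WithLp 2 (U × Y) →L[ℝ] U × Y)
  have he : ∀ p, e p = ((√ε)⁻¹ • p.fst, p.snd) := fun p => rfl
  let K : Submodule ℝ (WithLp 2 (U × Y)) := Z.comap (e : WithLp 2 (U × Y) →ₗ[ℝ] U × Y)
  have hK : IsClosed (K : Set (WithLp 2 (U × Y))) := hZ.preimage e.continuous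
  have : CompleteSpace K := hK.completeSpace_coe
  let x₀ : WithLp 2 (U × Y) := WithLp.toLp 2 (0, y)
  let p := K.starProjection x₀
  have hp : p ∈ K := K.starProjection_apply_mem x₀
  refine ⟨e p, hp, fun z' hz' => ?_⟩
  let q : WithLp 2 (U × Y) := WithLp.toLp 2 (√ε • z'.1, z'.2)
  have hq : q ∈ K := by
    change e q ∈ Z
    have : e q = z' := by
      rw [he]
      simp [q, smul_smul, inv_mul_cancel₀ hs]
    rwa [this]
  have horth := norm_add_sq_eq_norm_sq_add_norm_sq_of_inner_eq_zero (𝕜 := ℝ) (x₀ - p) (p - q)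
    (Submodule.starProjection_inner_eq_zero x₀ _ (K.sub_mem hp hq))
  have hsq : ∀ t : ℝ, (√ε * t) ^ 2 = ε * t ^ 2 := fun t => by
    rw [mul_pow, Real.sq_sqrt hε.le]
  have hfst : p.fst = √ε • (e p).1 := by
    rw [he]
    simp [smul_smul, mul_inv_cancel₀ hs]
  have h1 : ‖x₀ - q‖ ^ 2 = ‖z'.2 - y‖ ^ 2 + ε * ‖z'.1‖ ^ 2 := by
    rw [WithLp.prod_norm_sq_eq_of_L2]
    change ‖(0 : U) - √ε • z'.1‖ ^ 2 + ‖y - z'.2‖ ^ 2 = _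
    rw [zero_sub, norm_neg, norm_smul, Real.norm_of_nonneg (Real.sqrt_nonneg ε), hsq,
      norm_sub_rev, add_comm]
  have h2 : ‖x₀ - p‖ ^ 2 = ‖(e p).2 - y‖ ^ 2 + ε * ‖(e p).1‖ ^ 2 := by
    rw [WithLp.prod_norm_sq_eq_of_L2, WithLp.sub_fst, WithLp.sub_snd, hfst]
    change ‖(0 : U) - √ε • (e p).1‖ ^ 2 + ‖y - (e p).2‖ ^ 2 = _
    rw [zero_sub, norm_neg, norm_smul, Real.norm_of_nonneg (Real.sqrt_nonneg ε), hsq,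
      norm_sub_rev, add_comm]
  -- Only the first component of `p - q` is kept; the second is discarded as nonnegative.
  have h3 : ε * ‖(e p).1 - z'.1‖ ^ 2 ≤ ‖p - q‖ ^ 2 := by
    rw [WithLp.prod_norm_sq_eq_of_L2, WithLp.sub_fst, hfst]
    change _ ≤ ‖√ε • (e p).1 - √ε • z'.1‖ ^ 2 + ‖p.snd - z'.2‖ ^ 2
    rw [← smul_sub, norm_smul, Real.norm_of_nonneg (Real.sqrt_nonneg ε), hsq]
    exact le_add_of_nonneg_right (sq_nonneg _)
  rw [sub_add_sub_cancel] at horth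
  simp only [← sq] at horth
  linarith

/-- `hle` and `hex` say that `J` is the attained minimum of the cost over each fibre of `Z`, with
`⊤` permitted. Fibres may have several points: only the `U`-component has to be unique, and the
surplus term controls exactly that. -/
lemma existsUnique_minimizer_of_graph {U Y : Type*} [NormedAddCommGroup U] [InnerProductSpace ℝ U]
    [CompleteSpace U] [NormedAddCommGroup Y] [InnerProductSpace ℝ Y] [CompleteSpace Y]
    (Z : Submodule ℝ (U × Y)) (hZ : IsClosed (Z : Set (U × Y))) (y₀ : Y) {ε : ℝ} (hε : 0 < ε)
    (S : Submodule ℝ U) (J : U → ℝ≥0∞) (hZS : ∀ z ∈ Z, z.1 ∈ S)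
    (hle : ∀ z ∈ Z, J z.1 ≤ ENNReal.ofReal (‖z.2 - y₀‖ ^ 2 + ε * ‖z.1‖ ^ 2))
    (hex : ∀ u ∈ S, J u ≠ ⊤ →
      ∃ y, (u, y) ∈ Z ∧ J u = ENNReal.ofReal (‖y - y₀‖ ^ 2 + ε * ‖u‖ ^ 2)) :
    ∃! u, u ∈ S ∧ ∀ v ∈ S, J u ≤ J v := by
  obtain ⟨z, hz, hmin⟩ := exists_minimizer_of_isClosed Z hZ y₀ hε
  refine ⟨z.1, ⟨hZS z hz, fun v hv => ?_⟩, fun u ⟨hu, humin⟩ => ?_⟩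
  · by_cases hfin : J v = ⊤
    · exact hfin ▸ le_top
    obtain ⟨y, hy, heq⟩ := hex v hv hfin
    rw [heq]
    refine (hle z hz).trans
      (ENNReal.ofReal_le_ofReal ((le_add_of_nonneg_right ?_).trans (hmin _ hy)))
    positivity
  · have hu' := (humin z.1 (hZS z hz)).trans (hle z hz)
    obtain ⟨y, hy, heq⟩ := hex u hu (ne_top_of_le_ne_top ENNReal.ofReal_ne_top hu')
    rw [heq, ENNReal.ofReal_le_ofReal_iff (by positivity)] at hu'
    have h0 : ε * ‖z.1 - u‖ ^ 2 ≤ 0 := by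
      have := hmin _ hy
      linarith
    have h1 : ‖z.1 - u‖ ^ 2 ≤ 0 := nonpos_of_mul_nonpos_right h0 hε
    exact (sub_eq_zero.1 (norm_eq_zero.1 (pow_eq_zero_iff two_ne_zero |>.1
      (le_antisymm h1 (sq_nonneg _))))).symm

/-! ### The residual of the elliptic system -/

/-- The `m`-th component `L u_m - ∑_n s_mn u_n` of the residual. -/
def systemResidual {d : ℕ} {Ω : Set (Euc d)} (A a : Euc d → ℝ) (b : Euc d → Euc d)
    (c : Euc d → ℝ) (T : ℝ) (ψ : ℕ → ℝ → ℝ) {N : ℕ} (u : H2Vec Ω N) (m : Fin N) (x : Euc d) : ℝ :=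
  ellipticOp b c (u m) x - ∑ n : Fin N, couplingCoeff A a T ψ m n x * sobFn (u n) x

instance {d : ℕ} (Ω : Set (Euc d)) (N : ℕ) : InnerProductSpace ℝ (H2Vec Ω N) :=
  PiLp.innerProductSpace (fun _ : Fin N => H2 Ω)

section Residual

variable {d : ℕ} {Ω : Set (Euc d)} {A a : Euc d → ℝ} {b : Euc d → Euc d} {c : Euc d → ℝ} {T : ℝ}
  {ψ : ℕ → ℝ → ℝ} {N : ℕ}

lemma aestronglyMeasurable_systemResidual
    (hA : AEStronglyMeasurable A (volume.restrict Ω))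
    (ha : AEStronglyMeasurable a (volume.restrict Ω))
    (hb : AEStronglyMeasurable b (volume.restrict Ω))
    (hc : AEStronglyMeasurable c (volume.restrict Ω)) (hT : 0 < T)
    (hψ : ∀ n, ContDiffOn ℝ 2 (ψ n) (Icc 0 T)) (u : H2Vec Ω N) (m : Fin N) :
    AEStronglyMeasurable (systemResidual A a b c T ψ u m) (volume.restrict Ω) := by
  unfold systemResidual ellipticOp
  refine AEStronglyMeasurable.sub (((Finset.aestronglyMeasurable_fun_sum _ fun i _ => ?_).add
    (Finset.aestronglyMeasurable_fun_sum _ fun i _ => ?_)).add ?_)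
    (Finset.aestronglyMeasurable_fun_sum _ fun i _ => ?_)
  · exact Lp.aestronglyMeasurable _
  · exact ((EuclideanSpace.proj i).continuous.comp_aestronglyMeasurable hb).mul
      (Lp.aestronglyMeasurable _)
  · exact hc.mul (Lp.aestronglyMeasurable _)
  · exact (aestronglyMeasurable_couplingCoeff hA ha hT hψ m i).mul (Lp.aestronglyMeasurable _)

lemma systemResidual_add (u v : H2Vec Ω N) :
    ∀ᵐ x ∂volume.restrict Ω, ∀ m, systemResidual A a b c T ψ (u + v) m x =
      systemResidual A a b c T ψ u m x + systemResidual A a b c T ψ v m x := by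
  have h : ∀ᵐ x ∂volume.restrict Ω, ∀ m j,
      ((u + v) m).1 j x = (u m).1 j x + (v m).1 j x :=
    ae_all_iff.2 fun m => ae_all_iff.2 fun j => Lp.coeFn_add ((u m).1 j) ((v m).1 j)
  filter_upwards [h] with x hx m
  simp only [systemResidual, ellipticOp, sobFn, sobGrad, sobHess, hx, mul_add,
    Finset.sum_add_distrib]
  ring

lemma systemResidual_smul (r : ℝ) (u : H2Vec Ω N) :
    ∀ᵐ x ∂volume.restrict Ω, ∀ m, systemResidual A a b c T ψ (r • u) m x =
      r * systemResidual A a b c T ψ u m x := by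
  have h : ∀ᵐ x ∂volume.restrict Ω, ∀ m j, ((r • u) m).1 j x = r * (u m).1 j x :=
    ae_all_iff.2 fun m => ae_all_iff.2 fun j => Lp.coeFn_smul r ((u m).1 j)
  filter_upwards [h] with x hx m
  simp only [systemResidual, ellipticOp, sobFn, sobGrad, sobHess, hx, mul_sub, mul_add,
    Finset.mul_sum, mul_left_comm _ r]

/-- A single subsequence works for the whole finite family because it is extracted for the sum of
the `|v k i - w i|`, which dominates each term. -/
lemma exists_subseq_tendsto_ae {α ι : Type*} [Fintype ι] [MeasurableSpace α] {μ : Measure α}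
    {v : ℕ → ι → Lp ℝ 2 μ} {w : ι → Lp ℝ 2 μ}
    (h : ∀ i, Tendsto (fun k => v k i) atTop (𝓝 (w i))) :
    ∃ ns : ℕ → ℕ, StrictMono ns ∧
      ∀ᵐ x ∂μ, ∀ i, Tendsto (fun k => v (ns k) i x) atTop (𝓝 (w i x)) := by
  let g : ℕ → α → ℝ := fun k => ∑ i, fun x => ‖v k i x - w i x‖
  have hm : ∀ k i, AEStronglyMeasurable (fun x => ‖v k i x - w i x‖) μ := fun k i =>
    ((Lp.aestronglyMeasurable _).sub (Lp.aestronglyMeasurable _)).norm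
  have hg : Tendsto (fun k => eLpNorm (g k - 0) 2 μ) atTop (𝓝 0) := by
    have hs : Tendsto (fun k => ∑ i, eLpNorm (fun x => ‖v k i x - w i x‖) 2 μ) atTop (𝓝 0) := by
      have := tendsto_finsetSum Finset.univ fun i _ => tendsto_eLpNorm_sub (h i)
      simpa only [eLpNorm_norm, Finset.sum_const_zero] using this
    refine tendsto_of_tendsto_of_tendsto_of_le_of_le tendsto_const_nhds hs
      (fun _ => zero_le) fun k => ?_
    simp only [sub_zero]
    exact eLpNorm_sum_le (fun i _ => hm k i) (by norm_num)
  obtain ⟨ns, hns, hae⟩ := (tendstoInMeasure_of_tendsto_eLpNorm (by norm_num)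
    (fun k => Finset.aestronglyMeasurable_sum _ fun i _ => hm k i)
    aestronglyMeasurable_zero hg).exists_seq_tendsto_ae
  refine ⟨ns, hns, ?_⟩
  filter_upwards [hae] with x hx i
  rw [tendsto_iff_norm_sub_tendsto_zero]
  refine tendsto_of_tendsto_of_tendsto_of_le_of_le tendsto_const_nhds hx
    (fun _ => norm_nonneg _) fun k => ?_
  simp only [Finset.sum_apply]
  exact Finset.single_le_sum (f := fun i => ‖v (ns k) i x - w i x‖)
    (fun _ _ => norm_nonneg _) (Finset.mem_univ i)

lemma continuous_component_jet (m : Fin N) (j : DerivIdx d) :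
    Continuous fun u : H2Vec Ω N => (u m).1 j :=
  (continuous_jet j).comp (PiLp.proj 2 (fun _ : Fin N => H2 Ω) (𝕜 := ℝ) m).continuous

/-- The residual is a closed operator even when its coefficients are unbounded. Along a common
subsequence the jets and the `w k` converge a.e.; at such a point the residual is a finite linear
combination of jet values with fixed coefficients, so both limits agree. -/
lemma systemResidual_of_tendsto {u : ℕ → H2Vec Ω N} {u' : H2Vec Ω N}
    {w : ℕ → Fin N → L2 Ω} {w' : Fin N → L2 Ω}
    (hu : Tendsto u atTop (𝓝 u')) (hw : ∀ m, Tendsto (fun k => w k m) atTop (𝓝 (w' m)))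
    (h : ∀ k m, w k m =ᵐ[volume.restrict Ω] systemResidual A a b c T ψ (u k) m) (m : Fin N) :
    w' m =ᵐ[volume.restrict Ω] systemResidual A a b c T ψ u' m := by
  obtain ⟨ns, -, hae⟩ := exists_subseq_tendsto_ae (ι := Fin N ⊕ Fin N × DerivIdx d)
    (μ := volume.restrict Ω)
    (v := fun k => Sum.elim (w k) fun p => (u k p.1).1 p.2)
    (w := Sum.elim w' fun p => (u' p.1).1 p.2) (by
      rintro (m | ⟨m, j⟩)
      · exact hw m
      · exact ((continuous_component_jet m j).tendsto u').comp hu)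
  filter_upwards [hae, ae_all_iff.2 fun k => h k m] with x hx hk
  have hj : ∀ n j, Tendsto (fun k => (u (ns k) n).1 j x) atTop (𝓝 ((u' n).1 j x)) :=
    fun n j => hx (.inr (n, j))
  have hlim : Tendsto (fun k => systemResidual A a b c T ψ (u (ns k)) m x) atTop
      (𝓝 (systemResidual A a b c T ψ u' m x)) :=
    (((tendsto_finsetSum _ fun i _ => hj m _).add
      (tendsto_finsetSum _ fun i _ => (hj m _).const_mul _)).add ((hj m _).const_mul _)).sub
      (tendsto_finsetSum _ fun n _ => (hj n _).const_mul _)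
  exact tendsto_nhds_unique ((hx (.inl m)).congr fun k => hk (ns k)) hlim

end Residual

lemma isClosed_zeroTraceSpace {d : ℕ} (Ω : Set (Euc d)) (N : ℕ) :
    IsClosed (zeroTraceSpace Ω N : Set (H2Vec Ω N)) := by
  refine IsSeqClosed.isClosed fun u u' hmem hu m => ?_
  exact IsTrace.of_tendsto
    (((PiLp.proj 2 (fun _ : Fin N => H2 Ω) (𝕜 := ℝ) m).continuous.tendsto u').comp hu)
    tendsto_const_nhds fun k => hmem k m

/-! ### The functional as a distance -/

/-- Pairs of a family of interior residuals and a family of normal derivatives. -/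
abbrev ResidualSpace {d : ℕ} (Ω : Set (Euc d)) (N : ℕ) : Type :=
  WithLp 2 (PiLp 2 (fun _ : Fin N => L2 Ω) × PiLp 2 (fun _ : Fin N => Lp ℝ 2 (surfaceMeasure Ω)))

/-- The graph over the zero trace space of the (multivalued, partially defined) map sending `u` to
its interior residual and its normal derivative. -/
def residualGraph {d : ℕ} {Ω : Set (Euc d)} (hΩ : IsSmoothBoundedDomain Ω) (A a : Euc d → ℝ)
    (b : Euc d → Euc d) (c : Euc d → ℝ) (T : ℝ) (ψ : ℕ → ℝ → ℝ) (N : ℕ) :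
    Submodule ℝ (H2Vec Ω N × ResidualSpace Ω N) where
  carrier := {z | z.1 ∈ zeroTraceSpace Ω N ∧
    (∀ m, z.2.fst m =ᵐ[volume.restrict Ω] systemResidual A a b c T ψ z.1 m) ∧
    ∀ m, IsNormalDeriv Ω (z.1 m) (z.2.snd m)}
  zero_mem' := by
    refine ⟨zero_mem _, fun m => ?_, fun m => IsNormalDeriv.zero⟩
    -- The residual of `0` vanishes a.e. by homogeneity with factor `0`.
    filter_upwards [systemResidual_smul (A := A) (a := a) (b := b) (c := c) (T := T) (ψ := ψ) 0
      (0 : H2Vec Ω N), Lp.coeFn_zero ℝ 2 (volume.restrict Ω)] with x hx h0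
    have := hx m
    rw [zero_smul, zero_mul] at this
    exact h0.trans this.symm
  add_mem' := by
    rintro z z' ⟨h1, h2, h3⟩ ⟨k1, k2, k3⟩
    refine ⟨add_mem h1 k1, fun m => ?_, fun m => (h3 m).add hΩ (k3 m)⟩
    filter_upwards [systemResidual_add (A := A) (a := a) (b := b) (c := c) (T := T) (ψ := ψ)
      z.1 z'.1, Lp.coeFn_add (z.2.fst m) (z'.2.fst m), h2 m, k2 m] with x hx h0 e e'
    exact h0.trans ((congrArg₂ (· + ·) e e').trans (hx m).symm)
  smul_mem' := by
    rintro r z ⟨h1, h2, h3⟩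
    refine ⟨Submodule.smul_mem _ r h1, fun m => ?_, fun m => (h3 m).smul r⟩
    filter_upwards [systemResidual_smul (A := A) (a := a) (b := b) (c := c) (T := T) (ψ := ψ)
      r z.1, Lp.coeFn_smul r (z.2.fst m), h2 m] with x hx h0 e
    exact h0.trans ((congrArg (r * ·) e).trans (hx m).symm)

lemma isClosed_residualGraph {d : ℕ} {Ω : Set (Euc d)} (hΩ : IsSmoothBoundedDomain Ω)
    (A a : Euc d → ℝ) (b : Euc d → Euc d) (c : Euc d → ℝ) (T : ℝ) (ψ : ℕ → ℝ → ℝ) (N : ℕ) :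
    IsClosed (residualGraph hΩ A a b c T ψ N : Set (H2Vec Ω N × ResidualSpace Ω N)) := by
  refine IsSeqClosed.isClosed fun z z' hmem hz => ?_
  have hu : Tendsto (fun k => (z k).1) atTop (𝓝 z'.1) := (continuous_fst.tendsto z').comp hz
  have hy := ((WithLp.prodContinuousLinearEquiv 2 ℝ (PiLp 2 (fun _ : Fin N => L2 Ω))
    (PiLp 2 (fun _ : Fin N => Lp ℝ 2 (surfaceMeasure Ω)))).continuous.tendsto _).comp
      ((continuous_snd.tendsto z').comp hz)
  have hw : ∀ m, Tendsto (fun k => (z k).2.fst m) atTop (𝓝 (z'.2.fst m)) := fun m =>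
    ((PiLp.proj 2 (fun _ : Fin N => L2 Ω) (𝕜 := ℝ) m).continuous.tendsto _).comp
      ((continuous_fst.tendsto _).comp hy)
  have hg : ∀ m, Tendsto (fun k => (z k).2.snd m) atTop (𝓝 (z'.2.snd m)) := fun m =>
    ((PiLp.proj 2 (fun _ : Fin N => Lp ℝ 2 (surfaceMeasure Ω)) (𝕜 := ℝ) m).continuous.tendsto
      _).comp ((continuous_snd.tendsto _).comp hy)
  refine ⟨(isClosed_zeroTraceSpace Ω N).mem_of_tendsto hu (.of_forall fun k => (hmem k).1),
    systemResidual_of_tendsto hu hw fun k => (hmem k).2.1, fun m => ?_⟩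
  exact IsNormalDeriv.of_tendsto hΩ
    (((PiLp.proj 2 (fun _ : Fin N => H2 Ω) (𝕜 := ℝ) m).continuous.tendsto _).comp hu)
    (hg m) fun k => (hmem k).2.2 m

lemma lintegral_enorm_sub_sq {α : Type*} [MeasurableSpace α] {μ : Measure α} {F : α → ℝ}
    (hF : MemLp F 2 μ) (g : Lp ℝ 2 μ) :
    ∫⁻ x, ‖g x - F x‖ₑ ^ 2 ∂μ = ‖g - hF.toLp F‖ₑ ^ 2 := by
  rw [enorm_sq_eq_lintegral]
  refine lintegral_congr_ae ?_
  filter_upwards [Lp.coeFn_sub g (hF.toLp F), hF.coeFn_toLp] with x h1 h2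
  rw [h1, Pi.sub_apply, h2]

lemma normalMismatch_le {d : ℕ} {Ω : Set (Euc d)} {u : H2 Ω} {F : Euc d → ℝ}
    (hF : MemLp F 2 (surfaceMeasure Ω)) {g : Lp ℝ 2 (surfaceMeasure Ω)}
    (hg : IsNormalDeriv Ω u g) : normalMismatch Ω u F ≤ ‖g - hF.toLp F‖ₑ ^ 2 := by
  rw [← lintegral_enorm_sub_sq]
  exact iInf₂_le g hg

/-- The normal derivatives of `u` form a closed convex set, nonempty since an empty infimum would be
`⊤`; the infimum is attained at its point nearest to the data. -/
lemma exists_normalMismatch_eq {d : ℕ} {Ω : Set (Euc d)} (hΩ : IsSmoothBoundedDomain Ω) {u : H2 Ω}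
    {F : Euc d → ℝ} (hF : MemLp F 2 (surfaceMeasure Ω)) (hfin : normalMismatch Ω u F ≠ ⊤) :
    ∃ g, IsNormalDeriv Ω u g ∧ normalMismatch Ω u F = ‖g - hF.toLp F‖ₑ ^ 2 := by
  let K : Set (Lp ℝ 2 (surfaceMeasure Ω)) := {g | IsNormalDeriv Ω u g}
  have hne : K.Nonempty := by
    by_contra hemp
    refine hfin (iInf₂_eq_top.2 fun g hg => absurd ⟨g, hg⟩ hemp)
  have hclosed : IsClosed K := IsSeqClosed.isClosed fun g g' hmem hg =>
    IsNormalDeriv.of_tendsto hΩ tendsto_const_nhds hg hmem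
  have hconv : Convex ℝ K := by
    intro g hg g' hg' s t _ _ hst
    -- The combination is a normal derivative of `s • u + t • u`, which is `u` because `s + t = 1`.
    have := (IsNormalDeriv.smul s hg).add hΩ (IsNormalDeriv.smul t hg')
    rwa [← add_smul, hst, one_smul] at this
  obtain ⟨g, hg, hmin⟩ := exists_norm_eq_iInf_of_complete_convex hne hclosed.isComplete hconv
    (hF.toLp F)
  refine ⟨g, hg, le_antisymm (normalMismatch_le hF hg) (le_iInf₂ fun g' hg' => ?_)⟩
  rw [lintegral_enorm_sub_sq hF]
  refine pow_le_pow_left' ?_ 2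
  rw [enorm_le_iff_norm_le, norm_sub_rev, hmin, norm_sub_rev g']
  exact ciInf_le ⟨0, by rintro _ ⟨w, rfl⟩; exact norm_nonneg _⟩ (⟨g', hg'⟩ : K)

lemma enorm_sq_eq_ofReal {E : Type*} [SeminormedAddCommGroup E] (x : E) :
    ‖x‖ₑ ^ 2 = ENNReal.ofReal (‖x‖ ^ 2) := by
  rw [← ofReal_norm, ENNReal.ofReal_pow (norm_nonneg x)]

lemma sum_enorm_sq_add_eq_ofReal {d : ℕ} {Ω : Set (Euc d)} {N : ℕ} {F : Fin N → Euc d → ℝ}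
    (hF : ∀ m, MemLp (F m) 2 (surfaceMeasure Ω)) {ε : ℝ} (hε : 0 < ε) (u : H2Vec Ω N)
    (y : ResidualSpace Ω N) :
    (∑ m, ‖y.fst m‖ₑ ^ 2) + (∑ m, ‖y.snd m - (hF m).toLp (F m)‖ₑ ^ 2) +
        ENNReal.ofReal (ε * ‖u‖ ^ 2) =
      ENNReal.ofReal (‖y - WithLp.toLp 2 (0, WithLp.toLp 2 fun m => (hF m).toLp (F m))‖ ^ 2 +
        ε * ‖u‖ ^ 2) := by
  simp only [enorm_sq_eq_ofReal]
  rw [← ENNReal.ofReal_sum_of_nonneg fun _ _ => sq_nonneg _,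
    ← ENNReal.ofReal_sum_of_nonneg fun _ _ => sq_nonneg _,
    ← ENNReal.ofReal_add (Finset.sum_nonneg fun _ _ => sq_nonneg _)
      (Finset.sum_nonneg fun _ _ => sq_nonneg _),
    ← ENNReal.ofReal_add (by positivity) (by positivity), WithLp.prod_norm_sq_eq_of_L2,
    WithLp.sub_fst, WithLp.sub_snd, PiLp.norm_sq_eq_of_L2 _ (y.fst - _),
    PiLp.norm_sq_eq_of_L2 _ (y.snd - _)]
  simp only [PiLp.sub_apply, WithLp.toLp_fst, WithLp.toLp_snd, sub_zero]

/-- Only an inequality: the normal derivative stored in `z` need not be the one nearest to the data.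
-/
lemma quasiRevFunctional_le {d : ℕ} {Ω : Set (Euc d)} (hΩ : IsSmoothBoundedDomain Ω)
    {A a : Euc d → ℝ} {b : Euc d → Euc d} {c : Euc d → ℝ} {T : ℝ} {ψ : ℕ → ℝ → ℝ}
    {f : Euc d → ℝ → ℝ} {N : ℕ}
    (hF : ∀ m : Fin N, MemLp (fun x => ∫ t in (0)..T, f x t * ψ m t) 2 (surfaceMeasure Ω))
    {ε : ℝ} (hε : 0 < ε) {z : H2Vec Ω N × ResidualSpace Ω N}
    (hz : z ∈ residualGraph hΩ A a b c T ψ N) :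
    quasiRevFunctional Ω A a b c T ψ f ε N z.1 ≤ ENNReal.ofReal
      (‖z.2 - WithLp.toLp 2 (0, WithLp.toLp 2 fun m => (hF m).toLp _)‖ ^ 2 + ε * ‖z.1‖ ^ 2) := by
  obtain ⟨-, h2, h3⟩ := hz
  rw [← sum_enorm_sq_add_eq_ofReal hF hε]
  refine add_le_add_left (add_le_add (Finset.sum_le_sum fun m _ => le_of_eq ?_)
    (Finset.sum_le_sum fun m _ => normalMismatch_le (hF m) (h3 m))) _
  rw [enorm_sq_eq_lintegral]
  refine lintegral_congr_ae ?_
  filter_upwards [h2 m] with x hx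
  rw [hx, systemResidual]

/-- Finiteness of the functional puts the residual in L², given its measurability `hR`, and supplies
an optimal normal derivative for each component; together they form `y`. -/
lemma exists_quasiRevFunctional_eq {d : ℕ} {Ω : Set (Euc d)} (hΩ : IsSmoothBoundedDomain Ω)
    {A a : Euc d → ℝ} {b : Euc d → Euc d} {c : Euc d → ℝ} {T : ℝ} {ψ : ℕ → ℝ → ℝ}
    {f : Euc d → ℝ → ℝ} {N : ℕ}
    (hF : ∀ m : Fin N, MemLp (fun x => ∫ t in (0)..T, f x t * ψ m t) 2 (surfaceMeasure Ω))
    {ε : ℝ} (hε : 0 < ε) {u : H2Vec Ω N}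
    (hR : ∀ m, AEStronglyMeasurable (systemResidual A a b c T ψ u m) (volume.restrict Ω))
    (hu : u ∈ zeroTraceSpace Ω N) (hfin : quasiRevFunctional Ω A a b c T ψ f ε N u ≠ ⊤) :
    ∃ y, (u, y) ∈ residualGraph hΩ A a b c T ψ N ∧
      quasiRevFunctional Ω A a b c T ψ f ε N u = ENNReal.ofReal
        (‖y - WithLp.toLp 2 (0, WithLp.toLp 2 fun m => (hF m).toLp _)‖ ^ 2 + ε * ‖u‖ ^ 2) := by
  obtain ⟨hfin', -⟩ := ENNReal.add_ne_top.1 hfin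
  obtain ⟨hw, hg⟩ := ENNReal.add_ne_top.1 hfin'
  have hw' : ∀ m, MemLp (systemResidual A a b c T ψ u m) 2 (volume.restrict Ω) := fun m =>
    memLp_two_iff_lintegral.2 ⟨hR m, ENNReal.sum_lt_top.1 (lt_top_iff_ne_top.2 hw) m
      (Finset.mem_univ m)⟩
  choose g hgn hgeq using fun m => exists_normalMismatch_eq hΩ (hF m)
    (ENNReal.sum_lt_top.1 (lt_top_iff_ne_top.2 hg) m (Finset.mem_univ m)).ne
  refine ⟨WithLp.toLp 2 (WithLp.toLp 2 fun m => (hw' m).toLp _, WithLp.toLp 2 g),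
    ⟨hu, fun m => (hw' m).coeFn_toLp, hgn⟩, ?_⟩
  rw [← sum_enorm_sq_add_eq_ofReal hF hε]
  refine congrArg₂ _ (congrArg₂ _ (Finset.sum_congr rfl fun m _ => ?_)
    (Finset.sum_congr rfl fun m _ => hgeq m)) rfl
  rw [enorm_sq_eq_lintegral]
  refine lintegral_congr_ae ?_
  filter_upwards [(hw' m).coeFn_toLp] with x hx
  exact congrArg (fun r : ℝ => ‖r‖ₑ ^ 2) hx.symm

end

theorem mainTheorem3 (d : ℕ) (hd : 1 ≤ d) (Ω : Set (Euc d)) (hΩ : IsSmoothBoundedDomain Ω)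
    (T : ℝ) (hT : 0 < T)
    (A : Euc d → ℝ) (hA : ContDiffOn ℝ 1 A Ω) (hA_ge : ∀ x ∈ Ω, 1 ≤ A x)
    (a : Euc d → ℝ) (ha : MemLp a ⊤ (volume.restrict Ω))
    (b : Euc d → Euc d) (hb : MemLp b ⊤ (volume.restrict Ω))
    (c : Euc d → ℝ) (hc : MemLp c ⊤ (volume.restrict Ω))
    (Ψ : HilbertBasis ℕ ℝ (Lp ℝ 2 (volume.restrict (Set.Ioo 0 T))))
    (ψ : ℕ → ℝ → ℝ) (hψ : ∀ n, ContDiffOn ℝ 2 (ψ n) (Set.Icc 0 T))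
    (hψ_eq : ∀ n, Ψ n =ᵐ[volume.restrict (Set.Ioo 0 T)] ψ n)
    (f : Euc d → ℝ → ℝ)
    (hf : MemLp (Function.uncurry f) 2
      ((surfaceMeasure Ω).prod (volume.restrict (Set.Ioo 0 T))))
    (ε : ℝ) (hε : 0 < ε) (N : ℕ) :
    IsClosed (zeroTraceSpace Ω N : Set (H2Vec Ω N)) ∧
      ∃! u : H2Vec Ω N, u ∈ zeroTraceSpace Ω N ∧
        ∀ v ∈ zeroTraceSpace Ω N,
          quasiRevFunctional Ω A a b c T ψ f ε N u ≤ quasiRevFunctional Ω A a b c T ψ f ε N v := by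
  have hF : ∀ m : Fin N, MemLp (fun x => ∫ t in (0)..T, f x t * ψ m t) 2 (surfaceMeasure Ω) :=
    fun m => memLp_boundaryData hT hf (hψ m).continuousOn
  have hR : ∀ (u : H2Vec Ω N) m,
      AEStronglyMeasurable (systemResidual A a b c T ψ u m) (volume.restrict Ω) :=
    aestronglyMeasurable_systemResidual
      (hA.continuousOn.aestronglyMeasurable hΩ.isOpen.measurableSet) ha.1 hb.1 hc.1 hT hψ
  exact ⟨isClosed_zeroTraceSpace Ω N, existsUnique_minimizer_of_graph
    (residualGraph hΩ A a b c T ψ N) (isClosed_residualGraph hΩ A a b c T ψ N)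
    (WithLp.toLp 2 (0, WithLp.toLp 2 fun m => (hF m).toLp _)) hε (zeroTraceSpace Ω N)
    (quasiRevFunctional Ω A a b c T ψ f ε N) (fun z hz => hz.1)
    (fun z hz => quasiRevFunctional_le hΩ hF hε hz)
    fun u hu hfin => exists_quasiRevFunctional_eq hΩ hF hε (hR u) hu hfin⟩
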